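/- Let $G$ be a finite simple graph whose vertex set is the disjoint union of two nonempty sets $V_1,V_2$ with $|V_1|=n_1\ge n_2=|V_2|$, such that no two vertices of the same $V_i$ are adjacent and every vertex of $V_i$ has degree $d_i$ ($i=1,2$); that is, $G$ is $(d_1,d_2)$-biregular. Let $A$ be the adjacency matrix of $G$ and let $\lambda_1\ge\lambda_2\ge\cdots\ge\lambda_{n_2}$ be the $n_2$ largest eigenvalues of $A$, counted with multiplicity. Then the number of spanning trees of $G$ is \[ \frac{(d_1+d_2)\,d_1^{\,n_1-n_2}\prod_{i=2}^{n_2}\left(d_1d_2-\lambda_i^2\right)}{n_1+n_2}, \] where $d_1^{0}=1$ and an empty product equals $1$. -/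

import Mathlib

/-- `G` is `(d₁, d₂)`-biregular with respect to the parts `V₁`, `V₂`: these partition the vertex
set, no two vertices of the same part are adjacent, and every vertex of `Vᵢ` has degree `dᵢ`. -/
structure IsBiregularWith {V : Type*} [Fintype V] [DecidableEq V] (G : SimpleGraph V)
    [DecidableRel G.Adj] (d₁ d₂ : ℕ) (V₁ V₂ : Finset V) : Prop where
  disjoint : Disjoint V₁ V₂
  union_eq : V₁ ∪ V₂ = Finset.univ
  not_adj₁ : ∀ u ∈ V₁, ∀ v ∈ V₁, ¬ G.Adj u v
  not_adj₂ : ∀ u ∈ V₂, ∀ v ∈ V₂, ¬ G.Adj u v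
  degree₁ : ∀ v ∈ V₁, G.degree v = d₁
  degree₂ : ∀ v ∈ V₂, G.degree v = d₂

/-- The number of spanning trees of `G`: trees on the whole vertex set all of whose edges are
edges of `G`. -/
noncomputable def numSpanningTrees {V : Type*} (G : SimpleGraph V) : ℕ :=
  {T : SimpleGraph V | T ≤ G ∧ T.IsTree}.ncard

theorem adjMatrix_isHermitian_real {V : Type*} (G : SimpleGraph V) [DecidableRel G.Adj] :
    (G.adjMatrix ℝ).IsHermitian := by
  ext i j
  simp [G.adj_comm]

/-- The eigenvalues of the real adjacency matrix of `G`, repeated according to multiplicity and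
listed in decreasing order; the `i`-th largest one (counting from `1`) has index `i - 1`. -/
noncomputable def adjEigenvalues {V : Type*} [Fintype V] [DecidableEq V] (G : SimpleGraph V)
    [DecidableRel G.Adj] : Fin (Fintype.card V) → ℝ :=
  (adjMatrix_isHermitian_real G).eigenvalues₀

/-!
A spanning tree of a graph `G` rooted at `r` is the same as a *parent map*: a function on vertices
fixing `r`, sending every other vertex to a neighbour, all of whose orbits reach `r`. Expanding the
determinant of the Laplacian `L`, with its row at `r` replaced by a unit vector, by multilinearity in
the rows gives one term `det (1 - P)` for each function `f` with `f r = r` and `f v` adjacent to `v`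
otherwise. Here `P` is the matrix of `f` away from `r`. If all orbits reach `r` then `P` is nilpotent
and the term is `1`; if not, the indicator of the vertices that never reach `r` is in the kernel of
`1 - P` and the term is `0`. This is the matrix-tree theorem
(`SimpleGraph.det_updateRow_lapMatrix_eq_numSpanningTrees`). Summed over all roots, it says that the
linear coefficient of `det (X + L)` is `|V|` times the number of spanning trees
(`SimpleGraph.coeff_one_det_X_add_lapMatrix`).

For a biregular graph with biadjacency matrix `B`, block elimination computes both `det (X + L)` and
the characteristic polynomial of the adjacency matrix from the characteristic polynomial `q` of
`Bᵀ B`: they are `(X + d₁) ^ (n₁ - n₂) * q ((X + d₁) (X + d₂))` and `X ^ (n₁ - n₂) * q (X²)`. By the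
second formula, the `n₂` largest adjacency eigenvalues are the square roots of the roots of `q`
(`IsBiregularWith.adjEigenvalues_sq`). The largest root of `q` is `d₁ d₂`, the common row sum of
`Bᵀ B`. It contributes the factor `(X + d₁) (X + d₂) - d₁ d₂ = X (X + d₁ + d₂)` to `det (X + L)`, and
the linear coefficient is then the product of `d₁ + d₂` with the values at `0` of the other factors.
-/

/-! ### Counting spanning trees by parent maps -/

namespace SimpleGraph

variable {V : Type*}

/-- `f` is the parent map of a spanning tree of `G` rooted at `r`: it fixes the root, sends every
other vertex to a neighbour, and every vertex reaches the root under iteration. -/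
structure IsParentMap (G : SimpleGraph V) (r : V) (f : V → V) : Prop where
  map_root : f r = r
  adj : ∀ v, v ≠ r → G.Adj v (f v)
  exists_iterate : ∀ v, ∃ k, f^[k] v = r

/-- The graph whose edges join each vertex to its image under `f`. Fixed points of `f` give no
edge. -/
def functionalGraph (f : V → V) : SimpleGraph V := fromRel fun u v => f u = v

theorem functionalGraph_adj {f : V → V} {u v : V} :
    (functionalGraph f).Adj u v ↔ u ≠ v ∧ (f u = v ∨ f v = u) := by
  simp [functionalGraph]

namespace IsParentMap

variable {G : SimpleGraph V} {r : V} {f g : V → V}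

theorem functionalGraph_le (hf : G.IsParentMap r f) : functionalGraph f ≤ G := by
  have key : ∀ u v, u ≠ v → f u = v → G.Adj u v := by
    rintro u v hne rfl
    refine hf.adj u ?_
    rintro rfl
    exact hne hf.map_root.symm
  intro u v huv
  obtain ⟨hne, h | h⟩ := functionalGraph_adj.1 huv
  · exact key u v hne h
  · exact (key v u hne.symm h).symm

theorem connected_functionalGraph (hf : G.IsParentMap r f) : (functionalGraph f).Connected := by
  have key : ∀ k v, f^[k] v = r → (functionalGraph f).Reachable v r := by
    intro k
    induction k with
    | zero => rintro v rfl; exact Reachable.refl _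
    | succ k ih =>
      intro v hv
      have h := ih (f v) hv
      by_cases hfv : v = f v
      · rwa [← hfv] at h
      · exact (Adj.reachable (functionalGraph_adj.2 ⟨hfv, Or.inl rfl⟩)).trans h
  have hr : ∀ v, (functionalGraph f).Reachable v r := fun v =>
    let ⟨k, hk⟩ := hf.exists_iterate v
    key k v hk
  exact (connected_iff_exists_forall_reachable _).2 ⟨r, fun v => (hr v).symm⟩

/-- A connected functional graph has at most one edge per non-root vertex, so it is a tree. -/
theorem isTree_functionalGraph [Finite V] (hf : G.IsParentMap r f) :
    (functionalGraph f).IsTree := by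
  classical
  have := Fintype.ofFinite V
  have hsub : (functionalGraph f).edgeFinset ⊆
      (Finset.univ.erase r).image fun v => s(v, f v) := by
    intro e
    induction e using Sym2.ind with
    | _ u v =>
      intro he
      rw [mem_edgeFinset, mem_edgeSet, functionalGraph_adj] at he
      obtain ⟨hne, h | h⟩ := he
      · refine Finset.mem_image.2 ⟨u, Finset.mem_erase.2 ⟨?_, Finset.mem_univ _⟩, by rw [h]⟩
        rintro rfl
        exact hne (hf.map_root.symm.trans h)
      · refine Finset.mem_image.2 ⟨v, Finset.mem_erase.2 ⟨?_, Finset.mem_univ _⟩, ?_⟩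
        · rintro rfl
          exact hne (h.symm.trans hf.map_root)
        · rw [h, Sym2.eq_swap]
  have hle := (Finset.card_le_card hsub).trans Finset.card_image_le
  rw [Finset.card_erase_of_mem (Finset.mem_univ r), Finset.card_univ] at hle
  have hge := hf.connected_functionalGraph.card_vert_le_card_edgeSet_add_one
  have hpos : 0 < Fintype.card V := Fintype.card_pos_iff.2 ⟨r⟩
  refine isTree_iff_connected_and_card.2 ⟨hf.connected_functionalGraph, ?_⟩
  rw [Nat.card_eq_fintype_card, Nat.card_eq_fintype_card, ← edgeFinset_card] at hge ⊢
  omega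

/-- The tree determines its parent map. -/
theorem eq_of_functionalGraph_eq (hf : G.IsParentMap r f) (hg : G.IsParentMap r g)
    (h : functionalGraph f = functionalGraph g) : f = g := by
  have key : ∀ k v, f^[k] v = r → f v = g v := by
    intro k
    induction k with
    | zero => rintro v rfl; exact hf.map_root.trans hg.map_root.symm
    | succ k ih =>
      intro v hv
      by_cases hvr : v = r
      · rw [hvr, hf.map_root, hg.map_root]
      have hne : v ≠ f v := (hf.adj v hvr).ne
      have hadj : (functionalGraph g).Adj v (f v) :=
        h ▸ functionalGraph_adj.2 ⟨hne, Or.inl rfl⟩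
      obtain ⟨-, hgv | hgv⟩ := functionalGraph_adj.1 hadj
      · exact hgv.symm
      -- otherwise `f` swaps `v` and `f v`, and the orbit of `v` never reaches `r`
      · exfalso
        have hff : f (f v) = v := (ih (f v) hv).trans hgv
        have horb : ∀ j, f^[j] v = v ∨ f^[j] v = f v := by
          intro j
          induction j with
          | zero => exact Or.inl rfl
          | succ j ihj =>
            rw [Function.iterate_succ_apply']
            rcases ihj with h | h <;> rw [h]
            · exact Or.inr rfl
            · exact Or.inl hff
        rcases horb (k + 1) with h | h
        · exact hvr (h.symm.trans hv)
        · have hfr : f v = r := h.symm.trans hv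
          exact hvr (by rw [← hff, hfr, hf.map_root])
  funext v
  obtain ⟨k, hk⟩ := hf.exists_iterate v
  exact key k v hk

end IsParentMap

/-- In a connected graph every vertex other than `r` has a neighbour nearer to `r`. -/
theorem Connected.exists_adj_dist_lt {T : SimpleGraph V} (hT : T.Connected) {r v : V}
    (hv : v ≠ r) : ∃ w, T.Adj v w ∧ T.dist w r < T.dist v r := by
  obtain ⟨p, hp⟩ := hT.exists_walk_length_eq_dist v r
  cases p with
  | nil => exact absurd rfl hv
  | cons h q =>
    refine ⟨_, h, ?_⟩
    have := dist_le q
    rw [Walk.length_cons] at hp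
    omega

/-- Every rooted tree is the functional graph of a parent map. -/
theorem IsTree.exists_isParentMap [Finite V] {T : SimpleGraph V} (hT : T.IsTree) (r : V) :
    ∃ f, T.IsParentMap r f ∧ functionalGraph f = T := by
  classical
  choose! p hp using fun v (hv : v ≠ r) => hT.connected.exists_adj_dist_lt hv
  set f : V → V := fun v => if v = r then r else p v with hfdef
  have hfne : ∀ v, v ≠ r → f v = p v := fun v hv => if_neg hv
  have hf : T.IsParentMap r f := by
    refine ⟨if_pos rfl, fun v hv => hfne v hv ▸ (hp v hv).1, ?_⟩
    have key : ∀ n v, T.dist v r ≤ n → ∃ k, f^[k] v = r := by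
      intro n
      induction n with
      | zero =>
        intro v hv
        exact ⟨0, hT.connected.dist_eq_zero_iff.1 (Nat.le_zero.1 hv)⟩
      | succ n ih =>
        intro v hv
        by_cases hvr : v = r
        · exact ⟨0, hvr⟩
        · have h1 := (hp v hvr).2
          rw [← hfne v hvr] at h1
          obtain ⟨k, hk⟩ := ih (f v) (by omega)
          exact ⟨k + 1, hk⟩
    exact fun v => key _ v le_rfl
  exact ⟨f, hf, le_antisymm hf.functionalGraph_le
    ((isTree_iff_minimal_connected.1 hT).2 hf.connected_functionalGraph hf.functionalGraph_le)⟩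

/-- Whatever the root, spanning trees correspond to parent maps. -/
theorem numSpanningTrees_eq_ncard_isParentMap [Finite V] (G : SimpleGraph V) (r : V) :
    numSpanningTrees G = {f | G.IsParentMap r f}.ncard := by
  refine (Set.ncard_congr (fun f _ => functionalGraph f) ?_ ?_ ?_).symm
  · exact fun f hf => ⟨hf.functionalGraph_le, hf.isTree_functionalGraph⟩
  · exact fun f g hf hg h => hf.eq_of_functionalGraph_eq hg h
  · rintro T ⟨hTG, hT⟩
    obtain ⟨f, hf, hfT⟩ := hT.exists_isParentMap r
    exact ⟨f, ⟨hf.map_root, fun v hv => hTG (hf.adj v hv), hf.exists_iterate⟩, hfT⟩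

end SimpleGraph

section Algebra

open Matrix Polynomial

/-! ### The matrix-tree theorem -/

/-- The matrix of the partial function that is `f` away from `r` and undefined at `r`. -/
def parentMatrix {V : Type*} [DecidableEq V] (R : Type*) [Zero R] [One R] (r : V) (f : V → V) :
    Matrix V V R :=
  Matrix.of fun v w => if v ≠ r ∧ w = f v then 1 else 0

section ParentMatrix

variable {V : Type*} [Fintype V] [DecidableEq V] {R : Type*} [CommRing R] {r : V} {f : V → V}

theorem parentMatrix_mulVec (x : V → R) (v : V) :
    (parentMatrix R r f *ᵥ x) v = if v = r then 0 else x (f v) := by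
  by_cases hv : v = r <;> simp [parentMatrix, Matrix.mulVec, dotProduct, hv]

theorem isNilpotent_parentMatrix (hf : ∀ v, ∃ k, f^[k] v = r) :
    IsNilpotent (parentMatrix R r f) := by
  have key : ∀ k v (x : V → R), f^[k] v = r → ∀ m, k < m →
      (parentMatrix R r f ^ m *ᵥ x) v = 0 := by
    intro k
    induction k with
    | zero =>
      rintro v x rfl m hm
      obtain ⟨m, rfl⟩ := Nat.exists_eq_succ_of_ne_zero hm.ne'
      rw [pow_succ', ← mulVec_mulVec, parentMatrix_mulVec, Function.iterate_zero_apply, if_pos rfl]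
    | succ k ih =>
      intro v x hv m hm
      obtain ⟨m, rfl⟩ := Nat.exists_eq_succ_of_ne_zero (Nat.ne_zero_of_lt hm)
      rw [pow_succ', ← mulVec_mulVec, parentMatrix_mulVec, ih (f v) x hv m (by omega), ite_self]
  choose k hk using hf
  refine ⟨Finset.univ.sup k + 1, ?_⟩
  refine Matrix.ext_of_mulVec_single fun i => ?_
  funext v
  rw [key (k v) v _ (hk v) _ (Nat.lt_succ_of_le (Finset.le_sup (Finset.mem_univ v))), zero_mulVec,
    Pi.zero_apply]

theorem det_one_sub_parentMatrix_of_reaches [IsDomain R] (hf : ∀ v, ∃ k, f^[k] v = r) :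
    (1 - parentMatrix R r f).det = 1 := by
  have h := isUnit_charpolyRev_of_isNilpotent (isNilpotent_parentMatrix (R := R) hf)
  -- `charpolyRev` is `det (1 - X P)`; being a unit it is constant, and its value at `1` is sought
  obtain ⟨c, -, hc⟩ := Polynomial.isUnit_iff.1 h
  have h0 : c = 1 := by
    have := eval_charpolyRev (M := parentMatrix R r f)
    rwa [← hc, eval_C] at this
  have h1 := congrArg (Polynomial.eval 1) hc
  rw [eval_C, h0, charpolyRev, ← coe_evalRingHom, RingHom.map_det] at h1
  rw [h1]
  congr 1
  ext i j
  simp [Matrix.one_apply, apply_ite]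

/-- The indicator of the set of vertices which do not reach the root lies in the kernel. -/
theorem det_one_sub_parentMatrix_of_not_reaches [IsDomain R] (hf : ¬ ∀ v, ∃ k, f^[k] v = r) :
    (1 - parentMatrix R r f).det = 0 := by
  classical
  push Not at hf
  obtain ⟨v₀, hv₀⟩ := hf
  refine Matrix.exists_mulVec_eq_zero_iff.1
    ⟨fun v => if ∃ k, f^[k] v = r then 0 else 1, ?_, ?_⟩
  · intro h
    have := congrFun h v₀
    simp [hv₀] at this
  · funext v
    rw [sub_mulVec, Pi.sub_apply, one_mulVec, parentMatrix_mulVec]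
    by_cases hv : v = r
    · simp only [hv, if_true, sub_zero, Pi.zero_apply]
      exact if_pos ⟨0, rfl⟩
    · have : (∃ k, f^[k] v = r) ↔ ∃ k, f^[k] (f v) = r := by
        refine ⟨?_, fun ⟨k, hk⟩ => ⟨k + 1, hk⟩⟩
        rintro ⟨_ | k, hk⟩
        · exact absurd hk hv
        · exact ⟨k, hk⟩
      simp only [if_neg hv, this, sub_self, Pi.zero_apply]

end ParentMatrix

namespace SimpleGraph

/-- **Kirchhoff's matrix-tree theorem**. Replacing a row of the Laplacian by the corresponding unit
vector is the same, as far as the determinant is concerned, as deleting that row and column. -/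
theorem det_updateRow_lapMatrix_eq_numSpanningTrees {V : Type*} [Fintype V] [DecidableEq V]
    (G : SimpleGraph V) [DecidableRel G.Adj] (R : Type*) [CommRing R] [IsDomain R] (r : V) :
    ((G.lapMatrix R).updateRow r (Pi.single r 1)).det = numSpanningTrees G := by
  classical
  -- row `v` of the modified Laplacian is the sum of the vectors `g v w` over `w ∈ A v`
  set A : V → Finset V := fun v => if v = r then {r} else G.neighborFinset v with hA
  set g : V → V → V → R := fun v w =>
    Pi.single v 1 - if v = r then 0 else Pi.single w 1 with hg
  have hrow : (G.lapMatrix R).updateRow r (Pi.single r 1) = fun v => ∑ w ∈ A v, g v w := by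
    funext v
    by_cases hv : v = r
    · subst hv
      simp [hA, hg]
    · rw [updateRow_ne hv]
      funext w
      simp only [hA, hg, if_neg hv, Finset.sum_apply, Pi.sub_apply, Finset.sum_sub_distrib,
        Finset.sum_const, card_neighborFinset_eq_degree, lapMatrix, degMatrix, Matrix.sub_apply,
        adjMatrix_apply, Pi.single_apply, Finset.sum_ite_eq, mem_neighborFinset]
      simp [Matrix.diagonal_apply, eq_comm]
  have hterm : ∀ f : V → V, (Matrix.detRowAlternating (fun v => g v (f v)) : R) =
      if ∀ v, ∃ k, f^[k] v = r then 1 else 0 := by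
    intro f
    have : (fun v => g v (f v)) = (1 - parentMatrix R r f : Matrix V V R) := by
      funext v w
      by_cases hv : v = r <;>
        simp [hg, parentMatrix, hv, Matrix.one_apply, Pi.single_apply, eq_comm (a := w)]
    rw [this]
    split_ifs with h
    · exact det_one_sub_parentMatrix_of_reaches h
    · exact det_one_sub_parentMatrix_of_not_reaches h
  have hexp := (Matrix.detRowAlternating (n := V) (R := R)).toMultilinearMap.map_sum_finset g A
  rw [numSpanningTrees_eq_ncard_isParentMap G r, hrow]
  refine hexp.trans ((Finset.sum_congr rfl fun f _ => hterm f).trans ?_)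
  rw [Finset.sum_boole, ← Set.ncard_coe_finset]
  congr 2
  ext f
  simp only [Finset.coe_filter, Fintype.mem_piFinset, Set.mem_ofPred_eq, hA]
  constructor
  · rintro ⟨h1, h2⟩
    refine ⟨by simpa using h1 r, fun v hv => by simpa [hv] using h1 v, h2⟩
  · rintro ⟨h1, h2, h3⟩
    refine ⟨fun v => ?_, h3⟩
    by_cases hv : v = r
    · simp [hv, h1]
    · simpa [hv] using h2 v hv

end SimpleGraph

/-- The derivative of a determinant of polynomials, column by column. -/
theorem Matrix.derivative_det {n R : Type*} [Fintype n] [DecidableEq n] [CommRing R]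
    (M : Matrix n n R[X]) :
    derivative M.det = ∑ j, (M.updateCol j fun i => derivative (M i j)).det := by
  simp only [det_apply, derivative_sum]
  rw [Finset.sum_comm]
  refine Finset.sum_congr rfl fun σ _ => ?_
  rw [Units.smul_def, derivative_smul, derivative_prod_finset, Finset.smul_sum]
  refine Finset.sum_congr rfl fun j _ => ?_
  rw [← Finset.prod_erase_mul _ _ (Finset.mem_univ j), updateCol_self, Units.smul_def]
  congr 2
  exact Finset.prod_congr rfl fun k hk => (updateCol_ne (Finset.ne_of_mem_erase hk)).symm

/-- The linear coefficient of `det (X + M)` is the sum of the principal minors of `M` of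
corank one. -/
theorem Matrix.coeff_one_det_X_add {n R : Type*} [Fintype n] [DecidableEq n] [CommRing R]
    (M : Matrix n n R) :
    (det (scalar n (X : R[X]) + M.map C)).coeff 1 =
      ∑ j, (M.updateCol j (Pi.single j 1)).det := by
  have h : ∀ p : R[X], p.coeff 1 = eval 0 (derivative p) := fun p => by
    rw [← coeff_zero_eq_eval_zero, coeff_derivative]; simp
  rw [h, derivative_det, eval_finsetSum]
  refine Finset.sum_congr rfl fun j _ => ?_
  rw [← coe_evalRingHom, RingHom.map_det]
  congr 1
  ext i k
  by_cases hk : k = j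
  · subst hk
    by_cases hi : i = k <;> simp [hi, Matrix.diagonal_apply]
  · by_cases hi : i = k <;> simp [hk, hi, Matrix.diagonal_apply]

/-- The linear coefficient of `det (X + L)` counts the spanning trees with a marked vertex. -/
theorem SimpleGraph.coeff_one_det_X_add_lapMatrix {V : Type*} [Fintype V] [DecidableEq V]
    (G : SimpleGraph V) [DecidableRel G.Adj] (R : Type*) [CommRing R] [IsDomain R] :
    (det (scalar V (X : R[X]) + (G.lapMatrix R).map C)).coeff 1 =
      Fintype.card V * numSpanningTrees G := by
  rw [coeff_one_det_X_add, ← nsmul_eq_mul, ← Finset.card_univ]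
  refine Finset.sum_eq_card_nsmul fun r _ => ?_
  rw [← G.det_updateRow_lapMatrix_eq_numSpanningTrees R r, ← det_transpose,
    ← updateRow_transpose, (G.isSymm_lapMatrix (R := R)).eq]

/-! ### Determinants of bipartite matrices -/

/-- Eliminating the upper right block of a block matrix whose diagonal blocks are scalar.
Multiplying by `a ^ card n` avoids dividing by `a`. -/
theorem Matrix.det_fromBlocks_smul_one_mul_pow {m n R : Type*} [Fintype m] [Fintype n]
    [DecidableEq m] [DecidableEq n] [CommRing R] (a b : R) (B : Matrix m n R) (C : Matrix n m R) :
    (fromBlocks (a • 1) B C (b • 1)).det * a ^ Fintype.card n =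
      a ^ Fintype.card m * ((a * b) • 1 - C * B).det := by
  have h : fromBlocks (a • 1) B C (b • 1) * fromBlocks 1 (-B) 0 (a • 1) =
      fromBlocks (a • 1) 0 C ((a * b) • 1 - C * B) := by
    rw [fromBlocks_multiply]
    congr 1 <;> simp [smul_smul, sub_eq_neg_add]
  have := congrArg det h
  rwa [det_mul, det_fromBlocks_zero₂₁, det_fromBlocks_zero₁₂, det_one, one_mul, det_smul,
    det_smul, det_one, det_one, mul_one, mul_one] at this

theorem Matrix.det_smul_one_sub_map_C {n R : Type*} [Fintype n] [DecidableEq n] [CommRing R]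
    (M : Matrix n n R) (p : R[X]) : (p • 1 - M.map C).det = M.charpoly.comp p := by
  rw [charpoly, ← coe_compRingHom_apply, RingHom.map_det]
  congr 1
  ext i j : 1
  by_cases h : i = j <;> simp [h]

/-- The factor `a ^ card n` cancels over an integral domain, so the block determinant is expressed
through the characteristic polynomial of the Gram matrix `Bᵀ * B`. -/
theorem Matrix.det_fromBlocks_smul_one_map_C {m n R : Type*} [Fintype m] [Fintype n]
    [DecidableEq m] [DecidableEq n] [CommRing R] [IsDomain R] {a b : R[X]} (ha : a ≠ 0)
    (hmn : Fintype.card n ≤ Fintype.card m) (B : Matrix m n R) :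
    (fromBlocks (a • 1) (-B.map C) (-Bᵀ.map C) (b • 1)).det =
      a ^ (Fintype.card m - Fintype.card n) * (Bᵀ * B).charpoly.comp (a * b) := by
  refine mul_right_cancel₀ (pow_ne_zero (Fintype.card n) ha) ?_
  rw [det_fromBlocks_smul_one_mul_pow, Matrix.neg_mul, Matrix.mul_neg, neg_neg, ← Matrix.map_mul,
    det_smul_one_sub_map_C, mul_right_comm, ← pow_add, Nat.sub_add_cancel hmn]

/-! ### Eigenvalues of symmetric matrices -/

/-- If all entries of a real symmetric matrix are nonnegative and all row sums are `c`, then its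
largest eigenvalue is `c`: the constant vector is an eigenvector, and Gershgorin's theorem gives the
upper bound. -/
theorem Matrix.IsHermitian.eigenvalues₀_zero_of_row_sum {n : Type*} [Fintype n] [DecidableEq n]
    [Nonempty n] {M : Matrix n n ℝ} (hM : M.IsHermitian) {c : ℝ} (h0 : ∀ i j, 0 ≤ M i j)
    (hc : ∀ i, ∑ j, M i j = c) : hM.eigenvalues₀ ⟨0, Fintype.card_pos⟩ = c := by
  have hle : ∀ i, hM.eigenvalues i ≤ c := by
    intro i
    have hev : Module.End.HasEigenvalue (Matrix.toLin' M) (hM.eigenvalues i) := by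
      rw [Module.End.hasEigenvalue_iff_mem_spectrum, spectrum_toLin']
      exact hM.eigenvalues_mem_spectrum_real i
    obtain ⟨k, hk⟩ := eigenvalue_mem_ball hev
    rw [Metric.mem_closedBall, Real.dist_eq] at hk
    have h1 : ∑ j ∈ Finset.univ.erase k, ‖M k j‖ = ∑ j ∈ Finset.univ.erase k, M k j :=
      Finset.sum_congr rfl fun j _ => Real.norm_of_nonneg (h0 k j)
    have h2 := Finset.add_sum_erase Finset.univ (M k) (Finset.mem_univ k)
    rw [hc k] at h2
    have h3 := (le_abs_self _).trans hk
    linarith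
  have hmem : c ∈ spectrum ℝ M := by
    rw [← spectrum_toLin', ← Module.End.hasEigenvalue_iff_mem_spectrum]
    refine Module.End.hasEigenvalue_of_hasEigenvector (x := fun _ => 1)
      ⟨Module.End.mem_eigenspace_iff.2 ?_, fun h => ?_⟩
    · funext i
      simp [Matrix.mulVec, dotProduct, hc]
    · exact one_ne_zero (congrFun h (Classical.arbitrary n))
  rw [hM.spectrum_real_eq_range_eigenvalues] at hmem
  obtain ⟨i, hi⟩ := hmem
  refine le_antisymm ?_ ?_
  · have := hle ((Fintype.equivOfCardEq (Fintype.card_fin _)) ⟨0, Fintype.card_pos⟩)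
    rwa [eigenvalues, Equiv.symm_apply_apply] at this
  · rw [← hi]
    exact hM.eigenvalues₀_antitone (Nat.zero_le _)

theorem Matrix.IsHermitian.charpoly_eq_prod_eigenvalues₀ {n : Type*} [Fintype n] [DecidableEq n]
    {M : Matrix n n ℝ} (hM : M.IsHermitian) :
    M.charpoly = ∏ i, (X - C (hM.eigenvalues₀ i)) := by
  rw [hM.charpoly_eq]
  exact Equiv.prod_comp (Fintype.equivOfCardEq (Fintype.card_fin _)).symm
    fun i => X - C (hM.eigenvalues₀ i)

/-- If the spectrum of a real symmetric matrix consists of `± t i` and some zeros, with `t`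
decreasing and nonnegative, then its largest eigenvalues are the `t i`, in this order. -/
theorem Matrix.IsHermitian.eigenvalues₀_eq_of_charpoly {n : Type*} [Fintype n] [DecidableEq n]
    {M : Matrix n n ℝ} (hM : M.IsHermitian) {k m : ℕ} {t : Fin m → ℝ} (ht : Antitone t)
    (h0 : ∀ i, 0 ≤ t i) (hchar : M.charpoly = X ^ k * ∏ i, ((X - C (t i)) * (X - C (-t i))))
    (i : Fin (Fintype.card n)) (him : i.val < m) : hM.eigenvalues₀ i = t ⟨i, him⟩ := by
  have hneg : Monotone fun i => -t i := fun i j hij => neg_le_neg (ht hij)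
  have hroots : M.charpoly.roots =
      ((List.ofFn t ++ List.replicate k 0 ++ (List.ofFn fun i => -t i).reverse : List ℝ) :
        Multiset ℝ) := by
    have hp : ∀ u : Fin m → ℝ, (∏ i, (X - C (u i))).roots = (List.ofFn u : Multiset ℝ) := by
      intro u
      rw [← Fin.univ_val_map, ← roots_multiset_prod_X_sub_C (Multiset.map u _), Multiset.map_map]
      rfl
    have hne : ∀ u : Fin m → ℝ, ∏ i, (X - C (u i)) ≠ 0 := fun u =>
      Finset.prod_ne_zero_iff.2 fun i _ => X_sub_C_ne_zero _
    rw [hchar, Finset.prod_mul_distrib,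
      roots_mul (mul_ne_zero (pow_ne_zero _ X_ne_zero) (mul_ne_zero (hne _) (hne _))),
      roots_mul (mul_ne_zero (hne _) (hne _)), hp, hp, roots_X_pow, ← Multiset.coe_add,
      ← Multiset.coe_add, Multiset.coe_reverse, Multiset.nsmul_singleton,
      Multiset.coe_replicate]
    abel
  have hsorted : (List.ofFn t ++ List.replicate k 0 ++
      (List.ofFn fun i => -t i).reverse : List ℝ).SortedGE := by
    rw [List.sortedGE_iff_pairwise, List.pairwise_append, List.pairwise_append]
    refine ⟨⟨ht.sortedGE_ofFn.pairwise, List.pairwise_replicate.2 (Or.inr le_rfl), ?_⟩,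
      (List.sortedGE_reverse.2 hneg.sortedLE_ofFn).pairwise, ?_⟩
    · intro a ha b hb
      obtain ⟨i, rfl⟩ := (List.mem_ofFn' _ _).1 ha
      rw [(List.mem_replicate.1 hb).2]
      exact h0 i
    · intro a ha b hb
      obtain ⟨j, rfl⟩ := (List.mem_ofFn' _ _).1 (List.mem_reverse.1 hb)
      have ha0 : 0 ≤ a := by
        rcases List.mem_append.1 ha with ha | ha
        · obtain ⟨i, rfl⟩ := (List.mem_ofFn' _ _).1 ha
          exact h0 i
        · exact (List.mem_replicate.1 ha).2.ge
      exact (neg_nonpos.2 (h0 j)).trans ha0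
  -- two decreasing lists with the same entries are equal
  have hlist : List.ofFn hM.eigenvalues₀ = List.ofFn t ++ List.replicate k 0 ++
      (List.ofFn fun i => -t i).reverse := by
    refine List.Perm.eq_of_sortedGE hM.eigenvalues₀_antitone.sortedGE_ofFn hsorted
      (Multiset.coe_eq_coe.1 ?_)
    rw [← hroots, hM.roots_charpoly_eq_eigenvalues₀, Fin.univ_val_map]
    rfl
  have h1 : (List.ofFn hM.eigenvalues₀)[i.val]? = some (hM.eigenvalues₀ i) := by simp
  rw [hlist, List.append_assoc, List.getElem?_append_left (by simpa using him)] at h1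
  simpa [him] using h1.symm

/-! ### Biregular graphs -/

namespace SimpleGraph

variable {V : Type*} (G : SimpleGraph V) [DecidableRel G.Adj]

/-- The biadjacency matrix of a graph with respect to a vertex set and its complement. -/
def biadjMatrix (s : Finset V) : Matrix {v // v ∈ s} {v // v ∉ s} ℝ :=
  (G.adjMatrix ℝ).toBlock (· ∈ s) (· ∉ s)

theorem biadjMatrix_nonneg (s : Finset V) (v w) : 0 ≤ G.biadjMatrix s v w := by
  simp only [biadjMatrix, toBlock_apply, adjMatrix_apply]
  positivity

theorem isHermitian_biadjMatrix_gram (s : Finset V) :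
    ((G.biadjMatrix s)ᵀ * G.biadjMatrix s).IsHermitian :=
  isHermitian_conjTranspose_mul_self (G.biadjMatrix s)

/-- The squares of the singular values of the biadjacency matrix, in decreasing order. -/
noncomputable def biadjEigenvalues [Fintype V] [DecidableEq V] (s : Finset V) :
    Fin (Fintype.card {v // v ∉ s}) → ℝ :=
  (G.isHermitian_biadjMatrix_gram s).eigenvalues₀

theorem biadjEigenvalues_nonneg [Fintype V] [DecidableEq V] (s : Finset V) (i) :
    0 ≤ G.biadjEigenvalues s i := by
  have h := (posSemidef_conjTranspose_mul_self (G.biadjMatrix s)).eigenvalues_nonneg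
    ((Fintype.equivOfCardEq (Fintype.card_fin _)) i)
  rwa [IsHermitian.eigenvalues, Equiv.symm_apply_apply] at h

theorem charpoly_biadjMatrix_gram [Fintype V] [DecidableEq V] (s : Finset V) :
    ((G.biadjMatrix s)ᵀ * G.biadjMatrix s).charpoly = ∏ i, (X - C (G.biadjEigenvalues s i)) :=
  (G.isHermitian_biadjMatrix_gram s).charpoly_eq_prod_eigenvalues₀

end SimpleGraph

namespace IsBiregularWith

variable {V : Type*} [Fintype V] [DecidableEq V] {G : SimpleGraph V} [DecidableRel G.Adj]
  {d₁ d₂ : ℕ} {V₁ V₂ : Finset V}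

theorem notMem_iff (hG : IsBiregularWith G d₁ d₂ V₁ V₂) {v : V} : v ∉ V₁ ↔ v ∈ V₂ := by
  have h : v ∈ V₁ ∪ V₂ := hG.union_eq ▸ Finset.mem_univ v
  exact ⟨(Finset.mem_union.1 h).resolve_left, fun h₂ h₁ => Finset.disjoint_left.1 hG.disjoint h₁ h₂⟩

theorem card_eq_add (hG : IsBiregularWith G d₁ d₂ V₁ V₂) :
    Fintype.card V = V₁.card + V₂.card := by
  rw [← Finset.card_union_of_disjoint hG.disjoint, hG.union_eq, Finset.card_univ]

theorem card_subtype_notMem (hG : IsBiregularWith G d₁ d₂ V₁ V₂) :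
    Fintype.card {v // v ∉ V₁} = V₂.card :=
  (Fintype.card_congr (Equiv.subtypeEquivRight fun _ => hG.notMem_iff)).trans (Fintype.card_coe V₂)

theorem sum_biadjMatrix_row (hG : IsBiregularWith G d₁ d₂ V₁ V₂) (v : {v // v ∈ V₁}) :
    ∑ w, G.biadjMatrix V₁ v w = d₁ := by
  have h : ∑ w, G.adjMatrix ℝ v w = d₁ := by
    rw [← hG.degree₁ v v.2, ← G.card_neighborFinset_eq_degree, G.neighborFinset_eq_filter]
    simp
  rw [← Fintype.sum_subtype_add_sum_subtype (· ∈ V₁), Finset.sum_eq_zero, zero_add] at h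
  · exact h
  · exact fun w _ => by simp [hG.not_adj₁ v v.2 w w.2]

theorem sum_biadjMatrix_col (hG : IsBiregularWith G d₁ d₂ V₁ V₂) (w : {v // v ∉ V₁}) :
    ∑ v, G.biadjMatrix V₁ v w = d₂ := by
  have h : ∑ v, G.adjMatrix ℝ v w = d₂ := by
    rw [← hG.degree₂ w (hG.notMem_iff.1 w.2), ← G.card_neighborFinset_eq_degree,
      G.neighborFinset_eq_filter]
    simp [G.adj_comm _ w.1]
  rw [← Fintype.sum_subtype_add_sum_subtype (· ∈ V₁), add_comm, Finset.sum_eq_zero, zero_add] at h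
  · convert h using 1
    exact Finset.sum_congr (by ext; simp) fun _ _ => rfl
  · exact fun v _ => by
      simp [hG.not_adj₂ v (hG.notMem_iff.1 v.2) w (hG.notMem_iff.1 w.2)]

/-- The shape shared by the characteristic matrix of the adjacency matrix and by `X + L`. -/
theorem det_eq_of_diagonal_sub_adjMatrix (hG : IsBiregularWith G d₁ d₂ V₁ V₂)
    (hcard : V₂.card ≤ V₁.card) {a b : ℝ[X]} (ha : a ≠ 0) :
    (diagonal (fun v => if v ∈ V₁ then a else b) - (G.adjMatrix ℝ).map C).det =
      a ^ (V₁.card - V₂.card) *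
        ((G.biadjMatrix V₁)ᵀ * G.biadjMatrix V₁).charpoly.comp (a * b) := by
  set M : Matrix V V ℝ[X] :=
    diagonal (fun v => if v ∈ V₁ then a else b) - (G.adjMatrix ℝ).map C with hM
  have h₁₁ : M.toBlock (· ∈ V₁) (· ∈ V₁) = a • 1 := by
    ext i j : 1
    by_cases hij : i = j
    · subst hij; simp [hM, toBlock_apply]
    · have : (i : V) ≠ j := fun h => hij (Subtype.ext h)
      simp [hM, toBlock_apply, hij, this, hG.not_adj₁ i i.2 j j.2]
  have h₁₂ : M.toBlock (· ∈ V₁) (· ∉ V₁) = -(G.biadjMatrix V₁).map C := by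
    ext i j : 1
    have : (i : V) ≠ j := fun h => j.2 (h ▸ i.2)
    simp [hM, toBlock_apply, this, SimpleGraph.biadjMatrix]
  have h₂₁ : M.toBlock (· ∉ V₁) (· ∈ V₁) = -(G.biadjMatrix V₁)ᵀ.map C := by
    ext i j : 1
    have : (i : V) ≠ j := fun h => i.2 (h ▸ j.2)
    simp [hM, toBlock_apply, this, SimpleGraph.biadjMatrix, G.adj_comm]
  have h₂₂ : M.toBlock (· ∉ V₁) (· ∉ V₁) = b • 1 := by
    ext i j : 1
    by_cases hij : i = j
    · subst hij; simp [hM, toBlock_apply, i.2]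
    · have : (i : V) ≠ j := fun h => hij (Subtype.ext h)
      simp [hM, toBlock_apply, hij, this,
        hG.not_adj₂ i (hG.notMem_iff.1 i.2) j (hG.notMem_iff.1 j.2)]
  have h := det_fromBlocks_smul_one_map_C (b := b) ha
    (by rwa [hG.card_subtype_notMem, Fintype.card_coe]) (G.biadjMatrix V₁)
  rw [hG.card_subtype_notMem, Fintype.card_coe] at h
  rw [← h, det_toBlock M (· ∈ V₁), h₁₁, h₁₂, h₂₁, h₂₂]
  convert rfl

theorem charpoly_adjMatrix (hG : IsBiregularWith G d₁ d₂ V₁ V₂) (hcard : V₂.card ≤ V₁.card) :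
    (G.adjMatrix ℝ).charpoly = X ^ (V₁.card - V₂.card) *
      ((G.biadjMatrix V₁)ᵀ * G.biadjMatrix V₁).charpoly.comp (X * X) := by
  rw [← hG.det_eq_of_diagonal_sub_adjMatrix hcard X_ne_zero, charpoly, charmatrix]
  congr 2
  simp [scalar_apply]

theorem det_X_add_lapMatrix (hG : IsBiregularWith G d₁ d₂ V₁ V₂) (hcard : V₂.card ≤ V₁.card) :
    det (scalar V (X : ℝ[X]) + (G.lapMatrix ℝ).map C) =
      (X + C (d₁ : ℝ)) ^ (V₁.card - V₂.card) *
        ((G.biadjMatrix V₁)ᵀ * G.biadjMatrix V₁).charpoly.comp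
          ((X + C (d₁ : ℝ)) * (X + C (d₂ : ℝ))) := by
  -- `X + d₁` is a nonzero polynomial even if `d₁ = 0`
  rw [← hG.det_eq_of_diagonal_sub_adjMatrix hcard (X_add_C_ne_zero _)]
  congr 1
  ext i j : 1
  by_cases hij : i = j
  · subst hij
    by_cases hi : i ∈ V₁
    · simp [SimpleGraph.lapMatrix, SimpleGraph.degMatrix, hi, hG.degree₁ i hi]
    · simp [SimpleGraph.lapMatrix, SimpleGraph.degMatrix, hi, hG.degree₂ i (hG.notMem_iff.1 hi)]
  · simp [SimpleGraph.lapMatrix, SimpleGraph.degMatrix, hij]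

theorem gram_row_sum (hG : IsBiregularWith G d₁ d₂ V₁ V₂) (w : {v // v ∉ V₁}) :
    ∑ u, ((G.biadjMatrix V₁)ᵀ * G.biadjMatrix V₁) w u = (d₁ : ℝ) * d₂ := by
  simp only [mul_apply, transpose_apply]
  rw [Finset.sum_comm]
  simp only [← Finset.mul_sum, hG.sum_biadjMatrix_row, ← Finset.sum_mul, hG.sum_biadjMatrix_col]
  ring

/-- The `|V₂|` largest eigenvalues of the adjacency matrix are the singular values of the
biadjacency matrix. -/
theorem adjEigenvalues_sq (hG : IsBiregularWith G d₁ d₂ V₁ V₂) (hcard : V₂.card ≤ V₁.card)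
    (i : Fin (Fintype.card V)) (hi : i.val < Fintype.card {v // v ∉ V₁}) :
    adjEigenvalues G i ^ 2 = G.biadjEigenvalues V₁ ⟨i, hi⟩ := by
  have h := (adjMatrix_isHermitian_real G).eigenvalues₀_eq_of_charpoly
    (t := fun j => √(G.biadjEigenvalues V₁ j))
    (fun j k hjk => Real.sqrt_le_sqrt
      ((G.isHermitian_biadjMatrix_gram V₁).eigenvalues₀_antitone hjk))
    (fun j => Real.sqrt_nonneg _) (k := V₁.card - V₂.card) ?_ i hi
  · rw [adjEigenvalues, h, Real.sq_sqrt (G.biadjEigenvalues_nonneg V₁ _)]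
  · rw [hG.charpoly_adjMatrix hcard, G.charpoly_biadjMatrix_gram, prod_comp]
    congr 1
    refine Finset.prod_congr rfl fun j _ => ?_
    rw [sub_comp, X_comp, C_comp]
    nth_rw 1 [← Real.mul_self_sqrt (G.biadjEigenvalues_nonneg V₁ j)]
    rw [C_mul, C_neg]
    ring

/-- The factor of `det (X + L)` coming from the largest eigenvalue `d₁ d₂` is
`(X + d₁) (X + d₂) - d₁ d₂ = X (X + d₁ + d₂)`, and the linear coefficient is read off from it. -/
theorem card_mul_numSpanningTrees (hG : IsBiregularWith G d₁ d₂ V₁ V₂) (hV₂ : V₂.Nonempty)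
    (hcard : V₂.card ≤ V₁.card) :
    (Fintype.card V : ℝ) * numSpanningTrees G =
      ((d₁ : ℝ) + d₂) * (d₁ : ℝ) ^ (V₁.card - V₂.card) *
        ∏ i : Fin (Fintype.card {v // v ∉ V₁}) with 1 ≤ i.val,
          ((d₁ : ℝ) * d₂ - G.biadjEigenvalues V₁ i) := by
  have hpos : 0 < Fintype.card {v // v ∉ V₁} := hG.card_subtype_notMem ▸ hV₂.card_pos
  have : Nonempty {v // v ∉ V₁} := Fintype.card_pos_iff.1 hpos
  have htop : G.biadjEigenvalues V₁ ⟨0, hpos⟩ = (d₁ : ℝ) * d₂ :=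
    (G.isHermitian_biadjMatrix_gram V₁).eigenvalues₀_zero_of_row_sum
      (fun i j => Finset.sum_nonneg fun k _ =>
        mul_nonneg (G.biadjMatrix_nonneg V₁ k i) (G.biadjMatrix_nonneg V₁ k j))
      hG.gram_row_sum
  have hsplit : ∀ F : Fin (Fintype.card {v // v ∉ V₁}) → ℝ[X],
      ∏ i, F i = F ⟨0, hpos⟩ * ∏ i with 1 ≤ i.val, F i := by
    intro F
    rw [← Finset.mul_prod_erase _ F (Finset.mem_univ ⟨0, hpos⟩)]
    refine congrArg _ (Finset.prod_congr ?_ fun _ _ => rfl)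
    ext i
    rw [Finset.mem_erase, Finset.mem_filter, Ne, Fin.ext_iff, ← Ne, ← Nat.one_le_iff_ne_zero,
      and_comm]
  rw [← G.coeff_one_det_X_add_lapMatrix, hG.det_X_add_lapMatrix hcard,
    G.charpoly_biadjMatrix_gram, hsplit, htop, mul_comp, prod_comp]
  simp only [sub_comp, X_comp, C_comp]
  have hfac : (X + C (d₁ : ℝ)) * (X + C (d₂ : ℝ)) - C ((d₁ : ℝ) * d₂) =
      X * (X + C ((d₁ : ℝ) + d₂)) := by
    rw [C_mul, C_add]; ring
  rw [hfac, mul_left_comm, mul_assoc, coeff_X_mul, coeff_zero_eq_eval_zero]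
  simp [eval_prod]
  ring

end IsBiregularWith

end Algebra

/-- The index `i` counts from `0`, so the product runs over the second to the `n₂`-th largest
adjacency eigenvalue, where `n₂ = V₂.card`. -/
theorem mainTheorem8 {V : Type*} [Fintype V] [DecidableEq V] (G : SimpleGraph V)
    [DecidableRel G.Adj] (d₁ d₂ : ℕ) (V₁ V₂ : Finset V)
    (hG : IsBiregularWith G d₁ d₂ V₁ V₂) (hV₂ : V₂.Nonempty) (hcard : V₂.card ≤ V₁.card) :
    (numSpanningTrees G : ℝ) =
      (((d₁ : ℝ) + d₂) * (d₁ : ℝ) ^ (V₁.card - V₂.card) *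
        ∏ i : Fin (Fintype.card V) with 1 ≤ i.val ∧ i.val < V₂.card,
          ((d₁ : ℝ) * d₂ - adjEigenvalues G i ^ 2)) /
        ((V₁.card : ℝ) + V₂.card) := by
  have hpos : 0 < (V₁.card : ℝ) + V₂.card := by
    have : 0 < (V₂.card : ℝ) := Nat.cast_pos.2 hV₂.card_pos
    positivity
  have hm := hG.card_subtype_notMem
  have hle : Fintype.card {v // v ∉ V₁} ≤ Fintype.card V := Fintype.card_subtype_le _
  have h := hG.card_mul_numSpanningTrees hV₂ hcard
  rw [hG.card_eq_add, Nat.cast_add] at h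
  rw [eq_div_iff hpos.ne', mul_comm, h]
  congr 1
  refine Finset.prod_bij (fun i _ => Fin.castLE hle i) ?_ ?_ ?_ ?_
  · intro i hi
    simpa using ⟨(Finset.mem_filter.1 hi).2, hm ▸ i.2⟩
  · exact fun i _ j _ hij => Fin.castLE_injective hle hij
  · intro i hi
    obtain ⟨h1, h2⟩ := (Finset.mem_filter.1 hi).2
    exact ⟨⟨i, hm ▸ h2⟩, by simpa using h1, rfl⟩
  · intro i _
    rw [hG.adjEigenvalues_sq hcard (Fin.castLE hle i) i.2]
    rfl
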